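/- Let $\mathbb T=\bigcup_{n\ge 0}\{1,2\}^n$ be the set of finite words on $\{1,2\}$. A binary tree with masses is encoded by an element of $(\mathbb R_+)^{\mathbb T}\times\mathcal C(\mathbb R_+)^{\mathbb T}$: the lifetimes $(e_u)_{u\in\mathbb T}$ of the particles, and for each particle $u$, born at $b_u$ (the sum of the lifetimes of its strict ancestors) and dying at $d_u=b_u+e_u$, the function $s\mapsto X_{(b_u+s)\wedge d_u}(u)$, where $X_r(u)$ is the mass of $u$ at time $r$. The space $\mathcal C(\mathbb R_+)$ has the topology of uniform convergence on compact sets, and the space of codes has the product topology. The restriction of a tree to $[0,T]$ is the code $$\Big(\big((d_u\wedge T)-(b_u\wedge T)\big)_{u\in\mathbb T},\ \big(s\mapsto X_{(b_u+s)\wedge d_u\wedge T}(u)\,\mathbf 1_{\{b_u\le T\}}\big)_{u\in\mathbb T}\Big).$$ Let $(p,\lambda)$ be a solution on $[0,\infty)$ of $p'=(1-p)(\lambda-p)$, $\lambda'=-\lambda(1-p)$ with critical initial condition: $p(0)\in[0,1)$, $\lambda(0)\ge 1$ and $p(0)=\lambda(0)-\lambda(0)\log\lambda(0)$. Put $\rho(s)=(1-p(s))\lambda(s)$.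 For $t>0$ and $y>0$, the red tree $\mathfrak X^t$ of height $t$ under $\mathbb P_y$ is the time-inhomogeneous branching Markov process on $[0,t]$ such that: it starts at time $0$ with a unique particle of mass $y$; the mass of each particle grows linearly at speed $1$; a particle of mass $m$ at time $s$ splits at rate $\rho(t-s)m$ into two children, the mass $m$ being split uniformly between them; particles behave independently after their splitting time; all particles die at time $t$ at the latest, and the offspring of those dying at time $t$ have zero lifetime. For $x\ge 0$, let $\mathfrak X$ under $\mathbb P_x$ be the time-inhomogeneous branching Markov process on $[0,1)$ such that: it starts at time $0$ with a unique particle of mass $x$; the mass of each particle grows linearly at speed $1$; a particle of mass $m$ at time $s$ splits at rate $2m/(1-s)^2$ into two children, the mass $m$ being split uniformly between them; particles behave independently after their splitting time. Let $(x_t)_{t\ge 0}$ be positive real numbers with $x_t/t\to x\in\mathbb R_+$ as $t\to\infty$. Then for every $\varepsilon\in(0,1)$, as $t\to\infty$, the restriction to $[0,1-\varepsilon]$ of the rescaled tree $(\mathfrak X^t_{st}/t)_{s\in[0,1)}$ (lifetimes divided by $t$, masses divided by $t$, time accelerated by $t$) under $\mathbb P_{x_t}$ converges in law, in the space of codes,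 to the restriction to $[0,1-\varepsilon]$ of $\mathfrak X$ under $\mathbb P_x$. -/

import Mathlib

open MeasureTheory ProbabilityTheory Filter Topology
open scoped NNReal

namespace RedTree

noncomputable section

/-! ### Critical parameters and the differential system -/

/-- The critical set: pairs `(p, lam)` in `[0,1) × [1,∞)` with `p = lam - lam * log lam`. -/
def criticalSet : Set (ℝ × ℝ) :=
  {q | 0 ≤ q.1 ∧ q.1 < 1 ∧ 1 ≤ q.2 ∧ q.1 = q.2 - q.2 * Real.log q.2}

/-- `(p, lam)` solves `p' = (1 - p)(lam - p)`, `lam' = - lam (1 - p)` on `[0,∞)`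
(with one-sided derivatives at `0`). -/
def SolvesSystem (p lam : ℝ → ℝ) : Prop :=
  ∀ t : ℝ, 0 ≤ t →
    HasDerivWithinAt p ((1 - p t) * (lam t - p t)) (Set.Ici 0) t ∧
    HasDerivWithinAt lam (-(lam t * (1 - p t))) (Set.Ici 0) t

/-- The function `ρ(s) = (1 - p(s)) lam(s)`. -/
def rho (p lam : ℝ → ℝ) (s : ℝ) : ℝ := (1 - p s) * lam s

/-! ### Binary continuous trees with masses -/

/-- The set of finite words on a two-letter alphabet. A word is written from its last letter
to its first: `[]` is the root and `i :: u` is the child number `i` of the particle `u`. -/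
abbrev Word : Type := List (Fin 2)

/-- Encoding of a binary continuous tree with masses: the lengths of its branches, and for each
particle the continuous function giving its mass as a function of its age (frozen at its value at
the death time after this time). -/
def TreeCode : Type := (Word → ℝ≥0) × (Word → C(ℝ≥0, ℝ))

/-- The product topology, where `C(ℝ≥0, ℝ)` has the topology of uniform convergence on every
compact set. -/
instance : TopologicalSpace TreeCode :=
  inferInstanceAs (TopologicalSpace ((Word → ℝ≥0) × (Word → C(ℝ≥0, ℝ))))

instance : MeasurableSpace TreeCode := borel TreeCode

instance : BorelSpace TreeCode := ⟨rfl⟩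

namespace TreeCode

/-- The lifetime of a particle. -/
def lifetime (c : TreeCode) (u : Word) : ℝ≥0 := c.1 u

/-- The mass of a particle as a function of its age. -/
def mass (c : TreeCode) (u : Word) : C(ℝ≥0, ℝ) := c.2 u

/-- The birth time of a particle: the sum of the lifetimes of its strict ancestors. -/
def birth (c : TreeCode) : Word → ℝ≥0
  | [] => 0
  | _ :: u => birth c u + c.lifetime u

/-- The death time of a particle. -/
def death (c : TreeCode) (u : Word) : ℝ≥0 := c.birth u + c.lifetime u

/-- Rescaling of a tree by `t`, in time and in mass: `X_s` becomes `X_{st} / t`. -/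
def rescale (t : ℝ≥0) (c : TreeCode) : TreeCode :=
  (fun u => c.lifetime u / t,
   fun u => ⟨fun s => c.mass u (s * t) / (t : ℝ), by fun_prop⟩)

/-- Restriction of a tree to the time interval `[0, T]`: the particle `u` has lifetime
`(death ∧ T) - (birth ∧ T)`, and its mass function is `s ↦ X_{(birth + s) ∧ death ∧ T}(u)` if
`birth ≤ T`, and `0` otherwise. -/
def restrict (T : ℝ≥0) (c : TreeCode) : TreeCode :=
  (fun u => min (c.death u) T - min (c.birth u) T,
   fun u => if c.birth u ≤ T then
      ⟨fun s => c.mass u (min s (T - c.birth u)), by fun_prop⟩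
    else 0)

end TreeCode

/-! ### The time-inhomogeneous branching Markov process -/

/-- The standard exponential law. -/
def expLaw : Measure ℝ := expMeasure 1

instance : IsProbabilityMeasure expLaw := isProbabilityMeasure_expMeasure one_pos

/-- The randomness: for each word, an exponential clock (first coordinate) and a uniform variable
on `[0,1]` (second coordinate). -/
abbrev Noise : Type := Word → ℝ × unitInterval

/-- Under this probability, all the clocks and uniform variables are independent, the clocks are
standard exponential and the other variables are uniform on `[0,1]`. -/
def noiseLaw : Measure Noise :=
  Measure.infinitePi fun _ : Word => expLaw.prod (volume : Measure unitInterval)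

instance : IsProbabilityMeasure noiseLaw := by
  unfold noiseLaw; infer_instance

/-- Splitting age of a particle born at time `b` with mass `m`, when the mass grows at speed `1`
and a particle of mass `m'` at time `s` splits at rate `R s * m'`: the first age `r` at which the
integrated rate `∫_0^r R (b + v) (m + v) dv` reaches the exponential clock `E`, or at which the
time horizon `h` is reached. -/
def splitAge (R : ℝ → ℝ) (h : ℝ≥0) (b : ℝ≥0) (m E : ℝ) : ℝ≥0 :=
  sInf {r : ℝ≥0 | h ≤ b + r ∨ E ≤ ∫ v in (0 : ℝ)..r, R (b + v) * (m + v)}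

/-- Birth time and initial mass of each particle. At its death a particle of final mass `M` splits
its mass uniformly: its children receive the masses `U * M` and `(1 - U) * M`. -/
def birthState (R : ℝ → ℝ) (h : ℝ≥0) (x : ℝ) (ω : Noise) : Word → ℝ≥0 × ℝ
  | [] => (0, x)
  | i :: u =>
    let q := birthState R h x ω u
    let e := splitAge R h q.1 q.2 (ω u).1
    (q.1 + e,
      if i = 0 then ((ω u).2 : ℝ) * (q.2 + e) else (1 - ((ω u).2 : ℝ)) * (q.2 + e))

/-- Lifetime of each particle. -/
def lifetime (R : ℝ → ℝ) (h : ℝ≥0) (x : ℝ) (ω : Noise) (u : Word) : ℝ≥0 :=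
  splitAge R h (birthState R h x ω u).1 (birthState R h x ω u).2 (ω u).1

/-- The branching Markov process on the time interval `[0, h)`, started at time `0` from a unique
particle of mass `x`, in which masses grow linearly at speed `1`, a particle of mass `m` at time
`s` splits at rate `R s * m` into two children between which the mass is split uniformly, and
particles behave independently after their splitting time. All particles die at time `h` at the
latest, and the descendants of those that reach `h` have zero lifetime. -/
def growthFragmentation (R : ℝ → ℝ) (h : ℝ≥0) (x : ℝ) (ω : Noise) : TreeCode :=
  (fun u => lifetime R h x ω u,
   fun u => ⟨fun s => (birthState R h x ω u).2 + ((min s (lifetime R h x ω u) : ℝ≥0) : ℝ),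
    by fun_prop⟩)

/-- The red tree of height `t` started from the mass `x`: a particle of mass `m` at time `s`
splits at rate `ρ(t - s) m`. -/
def redTree (p lam : ℝ → ℝ) (t : ℝ≥0) (x : ℝ) (ω : Noise) : TreeCode :=
  growthFragmentation (fun s => rho p lam (t - s)) t x ω

/-- The limiting process on `[0, 1)` started from the mass `x`: a particle of mass `m` at time `s`
splits at rate `2 m / (1 - s) ^ 2`. -/
def limitTree (x : ℝ) (ω : Noise) : TreeCode :=
  growthFragmentation (fun s => 2 / (1 - s) ^ 2) 1 x ω

end

end RedTree

namespace RedTree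

noncomputable section

/-! ### Asymptotics of the critical solutions -/

/-! All the trees are built from the same noise, so convergence in law follows from almost sure
convergence under this coupling. Rescaling the red tree of height `t` gives the same construction on
`[0, 1)` with rate `t² ρ(t(1 - s))` (`rescale_growthFragmentation`). On the critical curve, with `u
= λ - 1`, one has `1 - p ~ u²/2`, hence `(1/u)' → 1/2`, `u ~ 2/t` and `t² ρ(t) → 2`. The rescaled
rate therefore tends to `2/(1 - s)²`, uniformly on each `[0, S]` with `S < 1`.

For fixed noise, a splitting age depends continuously on the rate, birth time and mass as long as it
falls before the horizon (`tendsto_splitAge`). In the limit it always does, because the integrated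
rate diverges at time 1 (`death_limitTree_lt_one`). Induction on words then gives convergence of
every birth state and lifetime. Restriction to `[0, T]` can be discontinuous only when a birth
occurs exactly at `T`, which has probability zero because the clocks are diffuse and independent
(`ae_birthState_fst_ne`). -/

/-- Solutions of a linear equation keep their sign, and stay zero if they start at zero. This is how
the invariants of the system are propagated. -/
theorem exists_integrating_factor {a f : ℝ → ℝ} (ha : ContinuousOn a (Set.Ici 0))
    (hf : ∀ t, 0 ≤ t → HasDerivWithinAt f (-(a t * f t)) (Set.Ici 0) t) :
    ∃ A : ℝ → ℝ, ∀ t, 0 ≤ t → f t = f 0 * Real.exp (-A t) := by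
  -- Extending `a` by a constant to the left of 0 makes its primitive differentiable on the whole
  -- line.
  set b : ℝ → ℝ := fun s => a (max s 0)
  have hb : Continuous b := by
    refine ha.comp_continuous (by fun_prop) fun s => ?_
    simp
  set A : ℝ → ℝ := fun t => ∫ s in (0 : ℝ)..t, b s
  have hA : ∀ t, HasDerivAt A (b t) t := fun t =>
    intervalIntegral.integral_hasDerivAt_right (hb.intervalIntegrable _ _)
      hb.aestronglyMeasurable.stronglyMeasurableAtFilter hb.continuousAt
  refine ⟨A, fun t ht => ?_⟩
  have hg : ∀ s ∈ Set.Ici (0 : ℝ),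
      HasDerivWithinAt (fun s => f s * Real.exp (A s)) 0 (Set.Ici 0) s := by
    intro s hs
    have h := (hf s hs).mul ((hA s).exp.hasDerivWithinAt (s := Set.Ici 0))
    refine h.congr_deriv ?_
    have : b s = a s := by simp only [b]; rw [max_eq_left hs]
    rw [this]; ring
  have hc : f t * Real.exp (A t) = f 0 * Real.exp (A 0) := by
    refine constant_of_has_deriv_right_zero (a := 0) (b := t)
      (f := fun s => f s * Real.exp (A s)) ?_ ?_ t ⟨ht, le_rfl⟩
    · exact fun s hs => ((hg s hs.1).continuousWithinAt).mono Set.Icc_subset_Ici_self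
    · exact fun s hs => (hg s hs.1).mono (Set.Ici_subset_Ici.2 hs.1)
  have hA0 : A 0 = 0 := intervalIntegral.integral_same
  rw [hA0, Real.exp_zero, mul_one] at hc
  rw [← hc, mul_assoc, ← Real.exp_add, add_neg_cancel, Real.exp_zero, mul_one]

namespace SolvesSystem

variable {p lam : ℝ → ℝ}

theorem continuousOn_fst (h : SolvesSystem p lam) : ContinuousOn p (Set.Ici 0) :=
  fun t ht => (h t ht).1.continuousWithinAt

theorem continuousOn_snd (h : SolvesSystem p lam) : ContinuousOn lam (Set.Ici 0) :=
  fun t ht => (h t ht).2.continuousWithinAt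

theorem snd_pos (h : SolvesSystem p lam) (h0 : 0 < lam 0) {t : ℝ} (ht : 0 ≤ t) : 0 < lam t := by
  obtain ⟨A, hA⟩ := exists_integrating_factor (a := fun t => 1 - p t) (f := lam)
    (continuousOn_const.sub h.continuousOn_fst) fun t ht => by
      exact (h t ht).2.congr_deriv (by ring)
  rw [hA t ht]; positivity

theorem fst_lt_one (h : SolvesSystem p lam) (h0 : p 0 < 1) {t : ℝ} (ht : 0 ≤ t) : p t < 1 := by
  obtain ⟨A, hA⟩ := exists_integrating_factor (a := fun t => lam t - p t) (f := fun t => 1 - p t)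
    (h.continuousOn_snd.sub h.continuousOn_fst) fun t ht => by
      exact ((h t ht).1.const_sub 1).congr_deriv (by ring)
  have h1 : 0 < 1 - p 0 := by linarith
  have h2 : 0 < 1 - p t := by rw [hA t ht]; positivity
  linarith

/-- The defect `f = p - λ + λ log λ` satisfies `f' = -(1 - p) f` and vanishes at 0. -/
theorem fst_eq (h : SolvesSystem p lam) (hcrit : (p 0, lam 0) ∈ criticalSet) {t : ℝ}
    (ht : 0 ≤ t) : p t = lam t - lam t * Real.log (lam t) := by
  obtain ⟨-, -, h1, h2⟩ := hcrit
  simp only at h1 h2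
  have hl : ∀ t, 0 ≤ t → 0 < lam t := fun t ht => h.snd_pos (by linarith) ht
  obtain ⟨A, hA⟩ := exists_integrating_factor (a := fun t => 1 - p t)
    (f := fun t => p t - lam t + lam t * Real.log (lam t))
    (continuousOn_const.sub h.continuousOn_fst) fun t ht => by
      have hne := (hl t ht).ne'
      refine (((h t ht).1.sub (h t ht).2).add
        ((h t ht).2.mul ((h t ht).2.log hne))).congr_deriv ?_
      field_simp
      ring
  have h3 := hA t ht
  have h4 : p 0 - lam 0 + lam 0 * Real.log (lam 0) = 0 := by rw [h2]; ring
  simp only [h4, zero_mul] at h3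
  linarith

/-- On the critical curve `λ = 1` forces `p = 1`, which is never reached; by continuity `λ` cannot
cross 1. -/
theorem one_lt_snd (h : SolvesSystem p lam) (hcrit : (p 0, lam 0) ∈ criticalSet) {t : ℝ}
    (ht : 0 ≤ t) : 1 < lam t := by
  have hne : ∀ s, 0 ≤ s → lam s ≠ 1 := fun s hs h1 => by
    have h2 := h.fst_eq hcrit hs
    have h3 := h.fst_lt_one hcrit.2.1 hs
    rw [h1] at h2
    simp at h2
    linarith
  by_contra! hle
  have hivt := intermediate_value_Icc' ht
    (h.continuousOn_snd.mono (show Set.Icc 0 t ⊆ Set.Ici 0 from Set.Icc_subset_Ici_self))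
  obtain ⟨s, hs, hs1⟩ := hivt ⟨hle, hcrit.2.2.1⟩
  exact hne s hs.1 hs1

theorem rho_pos (h : SolvesSystem p lam) (hcrit : (p 0, lam 0) ∈ criticalSet) {t : ℝ}
    (ht : 0 ≤ t) : 0 < rho p lam t :=
  mul_pos (by linarith [h.fst_lt_one hcrit.2.1 ht]) (by linarith [h.one_lt_snd hcrit ht])

theorem continuousOn_rho (h : SolvesSystem p lam) : ContinuousOn (rho p lam) (Set.Ici 0) :=
  (continuousOn_const.sub h.continuousOn_fst).mul h.continuousOn_snd

end SolvesSystem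

/-- With `λ = 1 + u` on the critical curve, the right side is `1 - p`. This bound and the next one
give `1 - p ~ u²/2`. -/
theorem sq_div_le_one_sub_add_mul_log {u : ℝ} (hu : 0 ≤ u) :
    u ^ 2 / (2 + u) ≤ 1 - (1 + u) + (1 + u) * Real.log (1 + u) := by
  have h := mul_le_mul_of_nonneg_left (Real.le_log_one_add_of_nonneg hu)
    (show 0 ≤ 1 + u by linarith)
  refine le_trans (le_of_eq ?_) (add_le_add_right h _)
  field_simp
  ring

theorem one_sub_add_mul_log_le {u : ℝ} (hu : 0 ≤ u) :
    1 - (1 + u) + (1 + u) * Real.log (1 + u) ≤ u ^ 2 / 2 := by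
  have h0 : 0 < 1 + u := by linarith
  -- This is `y ≤ sinh y` at `y = log (1 + u)`.
  have h1 : Real.log (1 + u) ≤ (1 + u - (1 + u)⁻¹) / 2 := by
    rw [← Real.sinh_log h0, Real.self_le_sinh_iff]
    exact Real.log_nonneg (by linarith)
  refine (add_le_add_right (mul_le_mul_of_nonneg_left h1 h0.le) _).trans (le_of_eq ?_)
  field_simp
  ring

/-- Along a critical solution, `lam t - 1` is equivalent to `2 / t`. -/
theorem SolvesSystem.tendsto_mul_snd_sub_one {p lam : ℝ → ℝ} (h : SolvesSystem p lam)
    (hcrit : (p 0, lam 0) ∈ criticalSet) :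
    Tendsto (fun t => t * (lam t - 1)) atTop (𝓝 2) := by
  set u : ℝ → ℝ := fun t => lam t - 1 with hu
  have hu0 : ∀ t, 0 ≤ t → 0 < u t := fun t ht => sub_pos.2 (h.one_lt_snd hcrit ht)
  have hlu : ∀ t, lam t = 1 + u t := fun t => by simp [hu]
  have hp : ∀ t, 0 ≤ t → 1 - p t = 1 - (1 + u t) + (1 + u t) * Real.log (1 + u t) := by
    intro t ht
    rw [h.fst_eq hcrit ht, hlu]; ring
  -- The inverse `v = 1/u` linearizes `u' ≈ -u²/2`: its derivative lies between `1/2` and `(1 +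
  -- u)/2`.
  set v : ℝ → ℝ := fun t => (u t)⁻¹ with hv
  have hv0 : ∀ t, 0 ≤ t → 0 < v t := fun t ht => inv_pos.2 (hu0 t ht)
  set v' : ℝ → ℝ := fun t => lam t * (1 - p t) / u t ^ 2 with hv'
  have hdv : ∀ t, 0 ≤ t → HasDerivWithinAt v (v' t) (Set.Ici 0) t := by
    intro t ht
    refine (((h t ht).2.sub_const 1).inv (hu0 t ht).ne').congr_deriv ?_
    simp [hv', hu]
  have hlow : ∀ t, 0 ≤ t → 1 / 2 ≤ v' t := by
    intro t ht
    have h0 := hu0 t ht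
    have h1 := sq_div_le_one_sub_add_mul_log h0.le
    rw [← hp t ht] at h1
    rw [hv', le_div_iff₀ (by positivity), hlu]
    refine le_trans ?_ (mul_le_mul_of_nonneg_left h1 (by linarith))
    rw [← sub_nonneg]
    have : (1 + u t) * (u t ^ 2 / (2 + u t)) - 1 / 2 * u t ^ 2 = u t ^ 3 / (2 * (2 + u t)) := by
      field_simp; ring
    rw [this]; positivity
  have hupp : ∀ t, 0 ≤ t → v' t ≤ (1 + u t) / 2 := by
    intro t ht
    have h0 := hu0 t ht
    have h1 := one_sub_add_mul_log_le h0.le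
    rw [← hp t ht] at h1
    rw [hv', div_le_iff₀ (by positivity), hlu]
    refine (mul_le_mul_of_nonneg_left h1 (by linarith)).trans (le_of_eq ?_)
    ring
  have hvlow : ∀ t, 0 ≤ t → v 0 + t / 2 ≤ v t := by
    have hd : ∀ t, 0 ≤ t →
        HasDerivWithinAt (fun t => v t - t / 2) (v' t - 1 / 2) (Set.Ici 0) t := fun t ht =>
      (hdv t ht).sub ((hasDerivWithinAt_id t _).div_const 2)
    have hm : MonotoneOn (fun t => v t - t / 2) (Set.Ici 0) := by
      refine monotoneOn_of_hasDerivWithinAt_nonneg (f' := fun t => v' t - 1 / 2) (convex_Ici 0)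
        (fun t ht => (hd t ht).continuousWithinAt)
        (fun t ht => (hd t (interior_subset ht)).mono interior_subset)
        (fun t ht => by linarith [hlow t (interior_subset ht)])
    intro t ht
    have := hm Set.self_mem_Ici ht ht
    simp only at this
    linarith
  -- Since `v' ≤ (1 + 1/v)/2`, the function `v - log (1 + v)` has derivative `v' v/(1 + v) ≤ 1/2`.
  -- The logarithm is negligible before `v`, so `v ~ t/2`.
  have hvupp : ∀ t, 0 ≤ t → v t - Real.log (1 + v t) ≤ v 0 + t / 2 := by
    have hd : ∀ t, 0 ≤ t →
        HasDerivWithinAt (fun t => t / 2 - (v t - Real.log (1 + v t)))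
          (1 / 2 - (v' t - v' t / (1 + v t))) (Set.Ici 0) t := fun t ht =>
      ((hasDerivWithinAt_id t _).div_const 2).sub ((hdv t ht).sub
        (((hdv t ht).const_add 1).log (by linarith [hv0 t ht])))
    have hm : MonotoneOn (fun t => t / 2 - (v t - Real.log (1 + v t))) (Set.Ici 0) := by
      refine monotoneOn_of_hasDerivWithinAt_nonneg
        (f' := fun t => 1 / 2 - (v' t - v' t / (1 + v t))) (convex_Ici 0)
        (fun t ht => (hd t ht).continuousWithinAt)
        (fun t ht => (hd t (interior_subset ht)).mono interior_subset)
        (fun t ht => ?_)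
      have h0 := hv0 t (interior_subset ht)
      have h1 := hupp t (interior_subset ht)
      have h2 : u t = 1 / v t := by simp [hv]
      have h3 : v' t - v' t / (1 + v t) = v' t * (v t / (1 + v t)) := by field_simp; ring
      have h4 := mul_le_mul_of_nonneg_right h1 (show 0 ≤ v t / (1 + v t) by positivity)
      have h5 : (1 + u t) / 2 * (v t / (1 + v t)) = 1 / 2 := by
        rw [h2]; field_simp; ring
      linarith
    intro t ht
    have h1 := hm Set.self_mem_Ici ht ht
    have h2 : 0 ≤ Real.log (1 + v 0) := Real.log_nonneg (by linarith [hv0 0 le_rfl])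
    simp only at h1
    linarith
  have hvtop : Tendsto v atTop atTop := by
    refine tendsto_atTop_mono' atTop ?_ (tendsto_atTop_add_const_left atTop (v 0)
      (tendsto_id.atTop_div_const (show (0 : ℝ) < 2 by norm_num)))
    filter_upwards [eventually_ge_atTop 0] with t ht using hvlow t ht
  have hlog : Tendsto (fun y : ℝ => Real.log (1 + y) / y) atTop (𝓝 0) := by
    have h1 : Tendsto (fun y : ℝ => Real.log (1 + y) / (1 + y)) atTop (𝓝 0) :=
      (Real.isLittleO_log_id_atTop.tendsto_div_nhds_zero).comp
        (tendsto_atTop_add_const_left atTop 1 tendsto_id)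
    have h2 : Tendsto (fun y : ℝ => 1 + y⁻¹) atTop (𝓝 (1 + 0)) :=
      tendsto_inv_atTop_zero.const_add 1
    have h3 := h1.mul h2
    rw [zero_mul] at h3
    refine h3.congr' ?_
    filter_upwards [eventually_gt_atTop 0] with y hy
    field_simp
    ring
  have hlim : Tendsto (fun t => 2 * (1 - Real.log (1 + v t) / v t) - 2 * v 0 * (v t)⁻¹) atTop
      (𝓝 (2 * (1 - 0) - 2 * v 0 * 0)) :=
    (((hlog.comp hvtop).const_sub 1).const_mul 2).sub
      ((tendsto_inv_atTop_zero.comp hvtop).const_mul _)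
  rw [sub_zero, mul_zero, sub_zero, mul_one] at hlim
  refine tendsto_of_tendsto_of_tendsto_of_le_of_le' hlim tendsto_const_nhds ?_ ?_
  · filter_upwards [eventually_ge_atTop 0] with t ht
    have h0 := hv0 t ht
    have h1 := hvupp t ht
    have h2 : u t = (v t)⁻¹ := by simp [hv]
    change _ ≤ t * u t
    rw [h2]
    field_simp
    linarith
  · filter_upwards [eventually_ge_atTop 0] with t ht
    have h0 := hv0 t ht
    have h1 := hvlow t ht
    have h3 := hv0 0 le_rfl
    have h2 : u t = (v t)⁻¹ := by simp [hv]
    change t * u t ≤ _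
    rw [h2, ← div_eq_mul_inv, div_le_iff₀ h0]
    linarith

theorem SolvesSystem.tendsto_sq_mul_rho {p lam : ℝ → ℝ} (h : SolvesSystem p lam)
    (hcrit : (p 0, lam 0) ∈ criticalSet) :
    Tendsto (fun t => t ^ 2 * rho p lam t) atTop (𝓝 2) := by
  have htu := h.tendsto_mul_snd_sub_one hcrit
  have hu : Tendsto (fun t => lam t - 1) atTop (𝓝 0) := by
    have h1 := htu.mul tendsto_inv_atTop_zero
    rw [mul_zero] at h1
    refine h1.congr' ?_
    filter_upwards [eventually_gt_atTop 0] with t ht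
    field_simp
  have hlow : Tendsto (fun t => (t * (lam t - 1)) ^ 2 / (2 + (lam t - 1)) * (1 + (lam t - 1))) atTop
      (𝓝 (2 ^ 2 / (2 + 0) * (1 + 0))) :=
    ((htu.pow 2).div (hu.const_add 2) (by norm_num)).mul (hu.const_add 1)
  have hupp : Tendsto (fun t => (t * (lam t - 1)) ^ 2 / 2 * (1 + (lam t - 1))) atTop
      (𝓝 (2 ^ 2 / 2 * (1 + 0))) :=
    ((htu.pow 2).div_const 2).mul (hu.const_add 1)
  norm_num only at hlow hupp
  have key : ∀ t, 0 ≤ t → 0 ≤ lam t - 1 ∧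
      1 - p t = 1 - (1 + (lam t - 1)) + (1 + (lam t - 1)) * Real.log (1 + (lam t - 1)) := by
    intro t ht
    refine ⟨by linarith [h.one_lt_snd hcrit ht], ?_⟩
    rw [h.fst_eq hcrit ht, add_sub_cancel]; ring
  refine tendsto_of_tendsto_of_tendsto_of_le_of_le' hlow hupp ?_ ?_
  · filter_upwards [eventually_ge_atTop 0] with t ht
    obtain ⟨h0, h1⟩ := key t ht
    have h2 := sq_div_le_one_sub_add_mul_log h0
    rw [← h1] at h2
    have h3 := mul_le_mul_of_nonneg_left h2 (show 0 ≤ t ^ 2 * lam t by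
      have : 0 ≤ lam t := by linarith
      positivity)
    refine le_trans (le_of_eq ?_) (h3.trans (le_of_eq ?_))
    · ring
    · unfold rho; ring
  · filter_upwards [eventually_ge_atTop 0] with t ht
    obtain ⟨h0, h1⟩ := key t ht
    have h2 := one_sub_add_mul_log_le h0
    rw [← h1] at h2
    have h3 := mul_le_mul_of_nonneg_left h2 (show 0 ≤ t ^ 2 * lam t by
      have : 0 ≤ lam t := by linarith
      positivity)
    refine le_trans (le_of_eq ?_) (h3.trans (le_of_eq ?_))
    · unfold rho; ring
    · ring

/-! ### Splitting ages -/

/-- The splitting rate integrated along the first `r` units of time of the life of a particle born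
at time `b` with mass `m`. -/
def splitIntegral (R : ℝ → ℝ) (b m r : ℝ) : ℝ := ∫ v in (0 : ℝ)..r, R (b + v) * (m + v)

/-- The ages at which the integrated rate has reached the clock or the horizon is reached. -/
def ripeAges (R : ℝ → ℝ) (h b : ℝ≥0) (m E : ℝ) : Set ℝ≥0 :=
  {r : ℝ≥0 | h ≤ b + r ∨ E ≤ splitIntegral R b m r}

theorem splitAge_eq (R : ℝ → ℝ) (h b : ℝ≥0) (m E : ℝ) :
    splitAge R h b m E = sInf (ripeAges R h b m E) := rfl

theorem ripeAges_nonempty (R : ℝ → ℝ) (h b : ℝ≥0) (m E : ℝ) : (ripeAges R h b m E).Nonempty :=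
  ⟨h, Or.inl le_add_self⟩

theorem splitAge_le {R : ℝ → ℝ} {h b : ℝ≥0} {m E : ℝ} {r : ℝ≥0} (hr : r ∈ ripeAges R h b m E) :
    splitAge R h b m E ≤ r := csInf_le (OrderBot.bddBelow _) hr

theorem splitAge_lt_iff {R : ℝ → ℝ} {h b : ℝ≥0} {m E : ℝ} {r : ℝ≥0} :
    splitAge R h b m E < r ↔ ∃ q ∈ ripeAges R h b m E, q < r :=
  csInf_lt_iff (OrderBot.bddBelow _) (ripeAges_nonempty R h b m E)

section

variable {R : ℝ → ℝ} {h : ℝ≥0}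

theorem continuousOn_splitRate (hc : ContinuousOn R (Set.Ico 0 h)) {b r : ℝ} (hb : 0 ≤ b)
    (hbr : b + r < h) (m : ℝ) : ContinuousOn (fun v => R (b + v) * (m + v)) (Set.Icc 0 r) := by
  refine (hc.comp (by fun_prop) fun v hv => ⟨?_, ?_⟩).mul (by fun_prop)
  · linarith [hv.1]
  · linarith [hv.2]

theorem intervalIntegrable_splitRate (hc : ContinuousOn R (Set.Ico 0 h)) {b r q : ℝ} (hb : 0 ≤ b)
    (hq : 0 ≤ q) (hqr : q ≤ r) (hbr : b + r < h) (m : ℝ) :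
    IntervalIntegrable (fun v => R (b + v) * (m + v)) volume q r :=
  ((continuousOn_splitRate hc hb hbr m).mono
    (Set.Icc_subset_Icc_left hq)).intervalIntegrable_of_Icc hqr

/-- The mass at age `v > 0` is at least `v`, so strictness holds even for initial mass zero. -/
theorem splitIntegral_lt (hc : ContinuousOn R (Set.Ico 0 h)) (hp : ∀ s ∈ Set.Ico (0 : ℝ) h, 0 < R s)
    {b m q r : ℝ} (hb : 0 ≤ b) (hm : 0 ≤ m) (hq : 0 ≤ q) (hqr : q < r) (hbr : b + r < h) :
    splitIntegral R b m q < splitIntegral R b m r := by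
  rw [← sub_pos]
  unfold splitIntegral
  rw [intervalIntegral.integral_interval_sub_left
    (intervalIntegrable_splitRate hc hb le_rfl (hq.trans hqr.le) hbr m)
    (intervalIntegrable_splitRate hc hb le_rfl hq (by linarith) m)]
  refine intervalIntegral.intervalIntegral_pos_of_pos_on
    (intervalIntegrable_splitRate hc hb hq hqr.le hbr m) (fun v hv => ?_) hqr
  exact mul_pos (hp _ ⟨by linarith [hv.1], by linarith [hv.2]⟩) (by linarith [hv.1])

theorem mem_ripeAges_of_le (hc : ContinuousOn R (Set.Ico 0 h))
    (hp : ∀ s ∈ Set.Ico (0 : ℝ) h, 0 < R s) {b : ℝ≥0} {m E : ℝ} {q r : ℝ≥0} (hm : 0 ≤ m)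
    (hq : q ∈ ripeAges R h b m E) (hqr : q ≤ r) : r ∈ ripeAges R h b m E := by
  rcases hqr.eq_or_lt with rfl | hlt
  · exact hq
  by_cases hbr : h ≤ b + r
  · exact Or.inl hbr
  rcases hq with hq | hq
  · exact Or.inl (hq.trans (by gcongr))
  · refine Or.inr (hq.trans (splitIntegral_lt hc hp b.2 hm q.2 (by exact_mod_cast hlt) ?_).le)
    exact_mod_cast not_le.1 hbr

theorem le_splitAge (hc : ContinuousOn R (Set.Ico 0 h)) (hp : ∀ s ∈ Set.Ico (0 : ℝ) h, 0 < R s)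
    {b : ℝ≥0} {m E : ℝ} {r : ℝ≥0} (hm : 0 ≤ m) (hr : r ∉ ripeAges R h b m E) :
    r ≤ splitAge R h b m E := by
  by_contra! hlt
  obtain ⟨q, hq, hqr⟩ := splitAge_lt_iff.1 hlt
  exact hr (mem_ripeAges_of_le hc hp hm hq hqr.le)

/-- Before the horizon, the integrated rate at the splitting age is equal to the clock. -/
theorem splitIntegral_splitAge (hc : ContinuousOn R (Set.Ico 0 h))
    (hp : ∀ s ∈ Set.Ico (0 : ℝ) h, 0 < R s) {b : ℝ≥0} {m E : ℝ} (hm : 0 ≤ m) (hE : 0 ≤ E)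
    (hlt : b + splitAge R h b m E < h) : splitIntegral R b m (splitAge R h b m E) = E := by
  set e := splitAge R h b m E with he
  -- An age beyond `e` but before the horizon makes the integral continuous on both sides of `e`.
  -- Earlier ages are not ripe and later ones are, so its value at `e` is squeezed to `E`.
  obtain ⟨r, her, hbr⟩ : ∃ r : ℝ≥0, e < r ∧ b + r < h := by
    obtain ⟨s, hs1, hs2⟩ := exists_between hlt
    have hbs : b ≤ s := le_self_add.trans hs1.le
    refine ⟨s - b, lt_tsub_iff_left.2 hs1, ?_⟩
    rwa [add_tsub_cancel_of_le hbs]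
  have hbr' : (b : ℝ) + r < h := by exact_mod_cast hbr
  have hcont : ContinuousOn (fun x => splitIntegral R b m x) (Set.Icc 0 r) := by
    have := intervalIntegral.continuousOn_primitive_interval (a := 0) (b := r) (μ := volume)
      (f := fun v => R (b + v) * (m + v)) (by
        rw [Set.uIcc_of_le (NNReal.coe_nonneg r)]
        exact (continuousOn_splitRate hc b.2 hbr' m).integrableOn_Icc)
    rwa [Set.uIcc_of_le (NNReal.coe_nonneg r)] at this
  have her' : (e : ℝ) < r := by exact_mod_cast her
  have hcat := hcont e ⟨e.2, her'.le⟩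
  apply le_antisymm
  · rcases eq_or_lt_of_le (bot_le : 0 ≤ e) with h0 | h0
    · rw [← h0]; simpa [splitIntegral] using hE
    · have h0' : (0 : ℝ) < e := by exact_mod_cast h0
      have hcl : Tendsto (fun x => splitIntegral R b m x) (𝓝[<] (e : ℝ))
          (𝓝 (splitIntegral R b m e)) := by
        refine hcat.mono_left (nhdsWithin_le_iff.2 ?_)
        filter_upwards [Ioo_mem_nhdsLT h0'] with x hx using ⟨hx.1.le, hx.2.le.trans her'.le⟩
      refine le_of_tendsto hcl ?_
      filter_upwards [Ioo_mem_nhdsLT h0'] with x hx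
      by_contra! hlt'
      have hmem : (⟨x, hx.1.le⟩ : ℝ≥0) ∈ ripeAges R h b m E := Or.inr hlt'.le
      have h1 : (e : ℝ) ≤ x := NNReal.coe_le_coe.2 (splitAge_le hmem)
      linarith [hx.2]
  · have hcr : Tendsto (fun x => splitIntegral R b m x) (𝓝[>] (e : ℝ))
        (𝓝 (splitIntegral R b m e)) := by
      refine hcat.mono_left (nhdsWithin_le_iff.2 ?_)
      filter_upwards [Ioo_mem_nhdsGT her'] with x hx using ⟨e.2.trans hx.1.le, hx.2.le⟩
    refine ge_of_tendsto hcr ?_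
    filter_upwards [Ioo_mem_nhdsGT her'] with x hx
    have hx0 : 0 ≤ x := e.2.trans hx.1.le
    obtain ⟨q, hq, hqx⟩ := splitAge_lt_iff.1
      (show splitAge R h b m E < ⟨x, hx0⟩ from NNReal.coe_lt_coe.1 hx.1)
    rcases mem_ripeAges_of_le hc hp hm hq hqx.le with hx' | hx'
    · have h1 : (h : ℝ) ≤ b + x := NNReal.coe_le_coe.2 hx'
      linarith [hx.2]
    · exact hx'

end

/-! ### Birth states -/

theorem birthState_cons (R : ℝ → ℝ) (h : ℝ≥0) (x : ℝ) (ω : Noise) (i : Fin 2) (u : Word) :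
    birthState R h x ω (i :: u) =
      ((birthState R h x ω u).1 + lifetime R h x ω u,
        (if i = 0 then ((ω u).2 : ℝ) else 1 - ((ω u).2 : ℝ)) *
          ((birthState R h x ω u).2 + lifetime R h x ω u)) := by
  rw [ite_mul]; rfl

theorem birthState_snd_nonneg (R : ℝ → ℝ) (h : ℝ≥0) {x : ℝ} (hx : 0 ≤ x) (ω : Noise) (u : Word) :
    0 ≤ (birthState R h x ω u).2 := by
  induction u with
  | nil => exact hx
  | cons i u ih =>
    rw [birthState_cons]
    refine mul_nonneg ?_ (add_nonneg ih (NNReal.coe_nonneg _))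
    split_ifs
    · exact (ω u).2.2.1
    · linarith [(ω u).2.2.2]

/-- Only strictly shorter words matter, so a particle's birth state is independent of its own clock.
-/
theorem birthState_congr (R : ℝ → ℝ) (h : ℝ≥0) (x : ℝ) {ω ω' : Noise} (u : Word)
    (hω : ∀ w : Word, w.length < u.length → ω w = ω' w) :
    birthState R h x ω u = birthState R h x ω' u := by
  induction u with
  | nil => rfl
  | cons i u ih =>
    have h1 := ih fun w hw => hω w (hw.trans (by simp))
    have h2 := hω u (by simp)
    simp only [birthState_cons, lifetime, h1, h2]

theorem birth_growthFragmentation (R : ℝ → ℝ) (h : ℝ≥0) (x : ℝ) (ω : Noise) (u : Word) :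
    (growthFragmentation R h x ω).birth u = (birthState R h x ω u).1 := by
  induction u with
  | nil => rfl
  | cons i u ih => rw [birthState_cons, TreeCode.birth, ih]; rfl

/-! ### Rescaling -/

/-- The change of variables contributes one factor `t` and the mass contributes the other. -/
theorem splitIntegral_mul (R : ℝ → ℝ) (t b m r : ℝ) :
    splitIntegral R (t * b) (t * m) (t * r) =
      splitIntegral (fun s => t ^ 2 * R (t * s)) b m r := by
  unfold splitIntegral
  have h1 := intervalIntegral.smul_integral_comp_mul_left (a := 0) (b := r)
    (fun v => R (t * b + v) * (t * m + v)) t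
  rw [mul_zero] at h1
  rw [← h1, smul_eq_mul, ← intervalIntegral.integral_const_mul]
  congr 1
  ext v
  rw [← mul_add, ← mul_add]
  ring

theorem splitAge_mul {t : ℝ≥0} (ht : 0 < t) (R : ℝ → ℝ) (h b : ℝ≥0) (m E : ℝ) :
    splitAge R (t * h) (t * b) (t * m) E =
      t * splitAge (fun s => (t : ℝ) ^ 2 * R (t * s)) h b m E := by
  have hmem : ∀ r : ℝ≥0, t * r ∈ ripeAges R (t * h) (t * b) (t * m) E ↔
      r ∈ ripeAges (fun s => (t : ℝ) ^ 2 * R (t * s)) h b m E := by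
    intro r
    simp only [ripeAges, Set.mem_ofPred_eq, NNReal.coe_mul, splitIntegral_mul, ← mul_add,
      mul_le_mul_iff_right₀ ht]
  apply le_antisymm
  · rw [← div_le_iff₀' ht, splitAge_eq _ h]
    refine le_csInf (ripeAges_nonempty _ _ _ _ _) fun r hr => ?_
    rw [div_le_iff₀' ht]
    exact splitAge_le ((hmem r).2 hr)
  · rw [splitAge_eq _ (t * h)]
    refine le_csInf (ripeAges_nonempty _ _ _ _ _) fun r hr => ?_
    rw [← le_div_iff₀' ht]
    refine splitAge_le ((hmem _).1 ?_)
    rwa [mul_div_cancel₀ r ht.ne']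

theorem birthState_mul {t : ℝ≥0} (ht : 0 < t) (R : ℝ → ℝ) (h : ℝ≥0) (x : ℝ) (ω : Noise)
    (u : Word) :
    birthState R (t * h) (t * x) ω u =
      (t * (birthState (fun s => (t : ℝ) ^ 2 * R (t * s)) h x ω u).1,
        t * (birthState (fun s => (t : ℝ) ^ 2 * R (t * s)) h x ω u).2) := by
  induction u with
  | nil => simp [birthState]
  | cons i u ih =>
    simp only [birthState_cons, lifetime, ih, splitAge_mul ht, NNReal.coe_mul]
    rw [Prod.mk.injEq]
    constructor <;> ring

theorem lifetime_mul {t : ℝ≥0} (ht : 0 < t) (R : ℝ → ℝ) (h : ℝ≥0) (x : ℝ) (ω : Noise)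
    (u : Word) :
    lifetime R (t * h) (t * x) ω u =
      t * lifetime (fun s => (t : ℝ) ^ 2 * R (t * s)) h x ω u := by
  simp only [lifetime, birthState_mul ht, splitAge_mul ht]

theorem rescale_growthFragmentation {t : ℝ≥0} (ht : 0 < t) (R : ℝ → ℝ) (h : ℝ≥0) (x : ℝ)
    (ω : Noise) :
    (growthFragmentation R (t * h) (t * x) ω).rescale t =
      growthFragmentation (fun s => (t : ℝ) ^ 2 * R (t * s)) h x ω := by
  have ht' : (t : ℝ) ≠ 0 := by exact_mod_cast ht.ne'
  refine Prod.ext (funext fun u => ?_) (funext fun u => ContinuousMap.ext fun s => ?_)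
  · change lifetime R (t * h) (t * x) ω u / t = lifetime _ h x ω u
    rw [lifetime_mul ht, mul_div_cancel_left₀ _ ht.ne']
  · change ((birthState R (t * h) (t * x) ω u).2 +
      ((min (s * t) (lifetime R (t * h) (t * x) ω u) : ℝ≥0) : ℝ)) / t =
      (birthState _ h x ω u).2 + ((min s (lifetime _ h x ω u) : ℝ≥0) : ℝ)
    rw [lifetime_mul ht, birthState_mul ht, mul_comm s t, ← mul_min_of_nonneg _ _ ht.le,
      NNReal.coe_mul, ← mul_add, mul_div_cancel_left₀ _ ht']

/-- Division by zero yields 0, so rescaling by 0 forgets the tree; this settles measurability at `t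
= 0`. -/
theorem rescale_zero (c c' : TreeCode) : c.rescale 0 = c'.rescale 0 := by
  refine Prod.ext (funext fun u => ?_) (funext fun u => ContinuousMap.ext fun s => ?_)
  · change c.lifetime u / 0 = c'.lifetime u / 0
    simp
  · change c.mass u (s * 0) / ((0 : ℝ≥0) : ℝ) = c'.mass u (s * 0) / ((0 : ℝ≥0) : ℝ)
    simp

/-! ### Stability of the splitting ages -/

section

variable {ι : Type*} {l : Filter ι} {Rn : ι → ℝ → ℝ} {R : ℝ → ℝ} {h : ℝ≥0}
  {bn : ι → ℝ≥0} {b : ℝ≥0} {mn : ι → ℝ} {m : ℝ}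

/-- Dominated convergence, with the ages kept inside `[0, S]` for some `S < h`, where the rates are
eventually uniformly bounded. -/
theorem tendsto_splitIntegral [l.IsCountablyGenerated]
    (hcn : ∀ᶠ n in l, ContinuousOn (Rn n) (Set.Ico 0 h)) (hc : ContinuousOn R (Set.Ico 0 h))
    (hu : ∀ S < (h : ℝ), TendstoUniformlyOn Rn R l (Set.Icc 0 S))
    (hb : Tendsto bn l (𝓝 b)) (hm : Tendsto mn l (𝓝 m)) {r : ℝ≥0} (hr : b + r < h) :
    Tendsto (fun n => splitIntegral (Rn n) (bn n) (mn n) r) l (𝓝 (splitIntegral R b m r)) := by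
  have hr' : (b : ℝ) + r < h := by exact_mod_cast hr
  obtain ⟨S, hS1, hS2⟩ := exists_between hr'
  have hb' : Tendsto (fun n => (bn n : ℝ)) l (𝓝 b) := (NNReal.continuous_coe.tendsto b).comp hb
  have hbS : ∀ᶠ n in l, (bn n : ℝ) + r < S := (hb'.add_const (r : ℝ)).eventually_lt_const hS1
  have hcS : ContinuousOn R (Set.Icc 0 S) := hc.mono fun s hs => ⟨hs.1, hs.2.trans_lt hS2⟩
  obtain ⟨C, hC⟩ := (isCompact_Icc (a := (0 : ℝ)) (b := S)).exists_bound_of_continuousOn hcS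
  have hRb : ∀ᶠ n in l, ∀ s ∈ Set.Icc 0 S, ‖Rn n s‖ ≤ C + 1 := by
    filter_upwards [Metric.tendstoUniformlyOn_iff.1 (hu S hS2) 1 one_pos] with n hn s hs
    have h1 := hn s hs
    rw [dist_eq_norm] at h1
    have h2 := norm_sub_norm_le (Rn n s) (R s)
    rw [norm_sub_rev] at h2
    linarith [hC s hs]
  have hmb : ∀ᶠ n in l, |mn n| < |m| + 1 := hm.abs.eventually_lt_const (by linarith)
  unfold splitIntegral
  refine intervalIntegral.tendsto_integral_filter_of_dominated_convergence
    (fun _ => (C + 1) * (|m| + 1 + r)) ?_ ?_ intervalIntegrable_const ?_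
  · filter_upwards [hcn, hbS] with n hn hbn
    rw [Set.uIoc_of_le (NNReal.coe_nonneg r)]
    exact ((continuousOn_splitRate hn (NNReal.coe_nonneg _) (hbn.trans hS2) _).mono
      Set.Ioc_subset_Icc_self).aestronglyMeasurable measurableSet_Ioc
  · filter_upwards [hRb, hbS, hmb] with n hn hbn hmn
    refine Eventually.of_forall fun v hv => ?_
    rw [Set.uIoc_of_le (NNReal.coe_nonneg r)] at hv
    have h1 := hn (bn n + v) ⟨add_nonneg (NNReal.coe_nonneg _) hv.1.le, by linarith [hv.2]⟩
    rw [norm_mul]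
    refine mul_le_mul h1 ?_ (norm_nonneg _) ((norm_nonneg _).trans h1)
    refine (norm_add_le _ _).trans ?_
    rw [Real.norm_eq_abs, Real.norm_eq_abs, abs_of_pos hv.1]
    linarith [hv.2]
  · refine Eventually.of_forall fun v hv => ?_
    rw [Set.uIoc_of_le (NNReal.coe_nonneg r)] at hv
    have hmem : (b : ℝ) + v ∈ Set.Icc 0 S :=
      ⟨add_nonneg (NNReal.coe_nonneg _) hv.1.le, by linarith [hv.2]⟩
    refine Tendsto.mul ((hu S hS2).tendsto_comp (hcS _ hmem) ?_) (hm.add_const v)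
    refine tendsto_nhdsWithin_iff.2 ⟨hb'.add_const v, ?_⟩
    filter_upwards [hbS] with n hn
    exact ⟨add_nonneg (NNReal.coe_nonneg _) hv.1.le, by linarith [hv.2]⟩

/-- Just below the limiting age the limiting integral is strictly less than `E`, and just above it
is strictly greater by strict monotonicity. Both inequalities persist along the filter. -/
theorem tendsto_splitAge [l.IsCountablyGenerated]
    (hcn : ∀ᶠ n in l, ContinuousOn (Rn n) (Set.Ico 0 h)) (hc : ContinuousOn R (Set.Ico 0 h))
    (hpn : ∀ᶠ n in l, ∀ s ∈ Set.Ico (0 : ℝ) h, 0 < Rn n s)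
    (hp : ∀ s ∈ Set.Ico (0 : ℝ) h, 0 < R s)
    (hu : ∀ S < (h : ℝ), TendstoUniformlyOn Rn R l (Set.Icc 0 S))
    (hb : Tendsto bn l (𝓝 b)) (hm : Tendsto mn l (𝓝 m)) (hmn0 : ∀ᶠ n in l, 0 ≤ mn n)
    (hm0 : 0 ≤ m) {E : ℝ} (he : b + splitAge R h b m E < h) :
    Tendsto (fun n => splitAge (Rn n) h (bn n) (mn n) E) l (𝓝 (splitAge R h b m E)) := by
  have hbr : ∀ r : ℝ≥0, b + r < h → ∀ᶠ n in l, bn n + r < h := fun r hr =>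
    (hb.add_const r).eventually_lt_const hr
  refine tendsto_order.2 ⟨fun a ha => ?_, fun a ha => ?_⟩
  · obtain ⟨r, har, hre⟩ := exists_between ha
    have hr : b + r < h := lt_of_le_of_lt (by gcongr) he
    have hnr : r ∉ ripeAges R h b m E := fun hmem => absurd (splitAge_le hmem) (not_le.2 hre)
    have hlt : splitIntegral R b m r < E := not_le.1 fun hle => hnr (Or.inr hle)
    filter_upwards [hcn, hpn, hmn0, hbr r hr,
      (tendsto_splitIntegral hcn hc hu hb hm hr).eventually_lt_const hlt] with n h1 h2 h3 h4 h5
    exact har.trans_le (le_splitAge h1 h2 h3 (not_or.2 ⟨not_le.2 h4, not_le.2 h5⟩))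
  · obtain ⟨r, her, hra, hr⟩ : ∃ r, splitAge R h b m E < r ∧ r < a ∧ b + r < h := by
      have h1 : splitAge R h b m E < min a (h - b) := lt_min ha (lt_tsub_iff_left.2 he)
      obtain ⟨r, hr1, hr2⟩ := exists_between h1
      exact ⟨r, hr1, (lt_min_iff.1 hr2).1, lt_tsub_iff_left.1 (lt_min_iff.1 hr2).2⟩
    obtain ⟨q, hq, hqr⟩ := splitAge_lt_iff.1 her
    have hlt : E < splitIntegral R b m r := by
      rcases hq with hq | hq
      · exact absurd (hq.trans (by gcongr : b + q ≤ b + r)) (not_le.2 hr)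
      · exact hq.trans_lt (splitIntegral_lt hc hp b.2 hm0 q.2 (by exact_mod_cast hqr)
          (by exact_mod_cast hr))
    filter_upwards [(tendsto_splitIntegral hcn hc hu hb hm hr).eventually_const_lt hlt] with n hn
    exact (splitAge_le (Or.inr hn.le)).trans_lt hra

theorem tendsto_birthState [l.IsCountablyGenerated]
    (hcn : ∀ᶠ n in l, ContinuousOn (Rn n) (Set.Ico 0 h)) (hc : ContinuousOn R (Set.Ico 0 h))
    (hpn : ∀ᶠ n in l, ∀ s ∈ Set.Ico (0 : ℝ) h, 0 < Rn n s)
    (hp : ∀ s ∈ Set.Ico (0 : ℝ) h, 0 < R s)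
    (hu : ∀ S < (h : ℝ), TendstoUniformlyOn Rn R l (Set.Icc 0 S))
    {xn : ι → ℝ} {x : ℝ} (hxn : Tendsto xn l (𝓝 x)) (hxn0 : ∀ᶠ n in l, 0 ≤ xn n) (hx0 : 0 ≤ x)
    {ω : Noise} (he : ∀ u, (birthState R h x ω u).1 + lifetime R h x ω u < h) (u : Word) :
    Tendsto (fun n => birthState (Rn n) h (xn n) ω u) l (𝓝 (birthState R h x ω u)) ∧
      Tendsto (fun n => lifetime (Rn n) h (xn n) ω u) l (𝓝 (lifetime R h x ω u)) := by
  have hlife : ∀ u, Tendsto (fun n => birthState (Rn n) h (xn n) ω u) l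
      (𝓝 (birthState R h x ω u)) →
      Tendsto (fun n => lifetime (Rn n) h (xn n) ω u) l (𝓝 (lifetime R h x ω u)) := fun u hbu =>
    tendsto_splitAge hcn hc hpn hp hu hbu.fst_nhds hbu.snd_nhds
      (hxn0.mono fun n hn => birthState_snd_nonneg _ _ hn ω u)
      (birthState_snd_nonneg _ _ hx0 ω u) (he u)
  suffices hb : Tendsto (fun n => birthState (Rn n) h (xn n) ω u) l
      (𝓝 (birthState R h x ω u)) from ⟨hb, hlife u hb⟩
  induction u with
  | nil => exact tendsto_const_nhds.prodMk_nhds hxn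
  | cons i u ih =>
    simp only [birthState_cons]
    have h1 := hlife u ih
    have h2 : Tendsto (fun n => (lifetime (Rn n) h (xn n) ω u : ℝ)) l
        (𝓝 (lifetime R h x ω u)) := (NNReal.continuous_coe.tendsto _).comp h1
    exact (ih.fst_nhds.add h1).prodMk_nhds ((ih.snd_nhds.add h2).const_mul _)

end

/-! ### Restricted trees -/

/-- Linear growth from `q.1` frozen at the ages `q.2.1` and `q.2.2`. -/
def frozenGrowth (q : ℝ × ℝ≥0 × ℝ≥0) : C(ℝ≥0, ℝ) :=
  ⟨fun s => q.1 + ((min (min s q.2.2) q.2.1 : ℝ≥0) : ℝ), by fun_prop⟩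

/-- Joint continuity in parameter and age gives continuity for uniform convergence on compact sets.
-/
theorem continuous_frozenGrowth : Continuous frozenGrowth := by
  refine ContinuousMap.continuous_of_continuous_uncurry _ ?_
  unfold Function.uncurry frozenGrowth
  simp only [ContinuousMap.coe_mk]
  fun_prop

theorem restrict_growthFragmentation (R : ℝ → ℝ) (h T : ℝ≥0) (x : ℝ) (ω : Noise) :
    (growthFragmentation R h x ω).restrict T =
      (fun u => min ((birthState R h x ω u).1 + lifetime R h x ω u) T -
        min (birthState R h x ω u).1 T,
      fun u => if (birthState R h x ω u).1 ≤ T then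
        frozenGrowth ((birthState R h x ω u).2, lifetime R h x ω u, T - (birthState R h x ω u).1)
        else 0) := by
  unfold TreeCode.restrict TreeCode.death
  simp only [birth_growthFragmentation]
  rfl

/-- Away from a birth at `T`, the indicator of `birth ≤ T` is eventually constant. -/
theorem tendsto_restrict_growthFragmentation {ι : Type*} {l : Filter ι} {Rn : ι → ℝ → ℝ}
    {R : ℝ → ℝ} {h T : ℝ≥0} {xn : ι → ℝ} {x : ℝ} {ω : Noise}
    (hlim : ∀ u, Tendsto (fun n => birthState (Rn n) h (xn n) ω u) l (𝓝 (birthState R h x ω u)) ∧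
      Tendsto (fun n => lifetime (Rn n) h (xn n) ω u) l (𝓝 (lifetime R h x ω u)))
    (hT : ∀ u, (birthState R h x ω u).1 ≠ T) :
    Tendsto (fun n => (growthFragmentation (Rn n) h (xn n) ω).restrict T) l
      (𝓝 ((growthFragmentation R h x ω).restrict T)) := by
  simp only [restrict_growthFragmentation]
  refine Tendsto.prodMk_nhds (tendsto_pi_nhds.2 fun u => ?_) (tendsto_pi_nhds.2 fun u => ?_)
  · obtain ⟨hb, he⟩ := hlim u
    exact ((hb.fst_nhds.add he).min tendsto_const_nhds).sub (hb.fst_nhds.min tendsto_const_nhds)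
  · obtain ⟨hb, he⟩ := hlim u
    rcases (hT u).lt_or_gt with hlt | hgt
    · rw [if_pos hlt.le]
      refine Tendsto.congr' (f₁ := fun n => frozenGrowth ((birthState (Rn n) h (xn n) ω u).2,
        lifetime (Rn n) h (xn n) ω u, T - (birthState (Rn n) h (xn n) ω u).1)) ?_ ?_
      · filter_upwards [hb.fst_nhds.eventually_lt_const hlt] with n hn
        rw [if_pos hn.le]
      · exact (continuous_frozenGrowth.tendsto _).comp
          (hb.snd_nhds.prodMk_nhds (he.prodMk_nhds (tendsto_const_nhds.sub hb.fst_nhds)))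
    · rw [if_neg (not_le.2 hgt)]
      refine tendsto_const_nhds.congr' ?_
      filter_upwards [hb.fst_nhds.eventually_const_lt hgt] with n hn
      rw [if_neg (not_le.2 hn)]

/-! ### Measurability -/

theorem measurable_splitIntegral {Ω : Type*} [MeasurableSpace Ω] {R : ℝ → ℝ} (hR : Measurable R)
    {b m : Ω → ℝ} {r : Ω → ℝ≥0} (hb : Measurable b) (hm : Measurable m) (hr : Measurable r) :
    Measurable fun ω => splitIntegral R (b ω) (m ω) (r ω) := by
  have heq : (fun ω => splitIntegral R (b ω) (m ω) (r ω)) = fun ω => ∫ v : ℝ,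
      if 0 < v ∧ v ≤ r ω then R (b ω + v) * (m ω + v) else 0 := by
    ext ω
    rw [splitIntegral, intervalIntegral.integral_of_le (NNReal.coe_nonneg _),
      ← integral_indicator measurableSet_Ioc]
    simp only [Set.indicator_apply, Set.mem_Ioc]
  rw [heq]
  have hmeas : Measurable fun z : Ω × ℝ =>
      if 0 < z.2 ∧ z.2 ≤ r z.1 then R (b z.1 + z.2) * (m z.1 + z.2) else 0 := by
    refine Measurable.ite ?_ (by fun_prop) measurable_const
    exact (measurableSet_lt measurable_const measurable_snd).inter
      (measurableSet_le measurable_snd (by fun_prop))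
  exact hmeas.stronglyMeasurable.integral_prod_right'.measurable

/-- The rate is controlled only on `[0, h)`. Cutting it off there makes it measurable without
changing the ripe ages. -/
theorem splitIntegral_indicator (R : ℝ → ℝ) {h b r : ℝ≥0} (hbr : b + r < h) (m : ℝ) :
    splitIntegral ((Set.Ico (0 : ℝ) h).indicator R) b m r = splitIntegral R b m r := by
  refine intervalIntegral.integral_congr fun v hv => ?_
  rw [Set.uIcc_of_le (NNReal.coe_nonneg r)] at hv
  have hbr' : (b : ℝ) + r < h := by exact_mod_cast hbr
  have hmem : (b : ℝ) + v ∈ Set.Ico (0 : ℝ) h :=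
    ⟨add_nonneg (NNReal.coe_nonneg b) hv.1, by linarith [hv.2]⟩
  simp only [Set.indicator_of_mem hmem]

theorem ripeAges_indicator (R : ℝ → ℝ) (h b : ℝ≥0) (m E : ℝ) :
    ripeAges ((Set.Ico (0 : ℝ) h).indicator R) h b m E = ripeAges R h b m E := by
  ext r
  by_cases hbr : h ≤ b + r
  · simp [ripeAges, hbr]
  · simp [ripeAges, hbr, splitIntegral_indicator R (not_le.1 hbr)]

section

variable {R : ℝ → ℝ} {h : ℝ≥0} {x : ℝ}

theorem measurable_indicator_rate (hc : ContinuousOn R (Set.Ico 0 h)) :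
    Measurable ((Set.Ico (0 : ℝ) h).indicator R) := by
  classical
  rw [← Set.piecewise_eq_indicator]
  exact hc.measurable_piecewise continuousOn_const measurableSet_Ico

theorem measurable_splitAge {Ω : Type*} [MeasurableSpace Ω] (hc : ContinuousOn R (Set.Ico 0 h))
    (hp : ∀ s ∈ Set.Ico (0 : ℝ) h, 0 < R s) {b : Ω → ℝ≥0} {m E : Ω → ℝ} (hb : Measurable b)
    (hm : Measurable m) (hE : Measurable E) (hm0 : ∀ ω, 0 ≤ m ω) :
    Measurable fun ω => splitAge R h (b ω) (m ω) (E ω) := by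
  obtain ⟨D, hDc, hD⟩ := TopologicalSpace.exists_countable_dense ℝ≥0
  refine measurable_of_Iio fun a => ?_
  -- Ripe ages are closed upwards, so ages in a countable dense set detect a splitting age below
  -- `a`.
  have heq : (fun ω => splitAge R h (b ω) (m ω) (E ω)) ⁻¹' Set.Iio a =
      ⋃ d ∈ D ∩ Set.Iio a, {ω | d ∈ ripeAges R h (b ω) (m ω) (E ω)} := by
    ext ω
    simp only [Set.mem_preimage, Set.mem_Iio, Set.mem_iUnion, Set.mem_ofPred_eq, exists_prop]
    refine ⟨fun hlt => ?_, fun ⟨d, hd, hmem⟩ => (splitAge_le hmem).trans_lt hd.2⟩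
    obtain ⟨q, hq, hqa⟩ := splitAge_lt_iff.1 hlt
    obtain ⟨d, hd, hqd, hda⟩ := hD.exists_between hqa
    exact ⟨d, ⟨hd, hda⟩, mem_ripeAges_of_le hc hp (hm0 ω) hq hqd.le⟩
  rw [heq]
  refine MeasurableSet.biUnion (hDc.mono Set.inter_subset_left) fun d _ => ?_
  simp only [← ripeAges_indicator R]
  exact (measurableSet_le measurable_const (hb.add_const d)).union
    (measurableSet_le hE (measurable_splitIntegral (measurable_indicator_rate hc)
      hb.coe_nnreal_real hm measurable_const))

theorem measurable_birthState (hc : ContinuousOn R (Set.Ico 0 h))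
    (hp : ∀ s ∈ Set.Ico (0 : ℝ) h, 0 < R s) (hx : 0 ≤ x) (u : Word) :
    Measurable (fun ω => birthState R h x ω u) ∧ Measurable (fun ω => lifetime R h x ω u) := by
  have hlife : ∀ u, Measurable (fun ω => birthState R h x ω u) →
      Measurable (fun ω => lifetime R h x ω u) := fun u hu =>
    measurable_splitAge hc hp hu.fst hu.snd (measurable_pi_apply u).fst
      fun ω => birthState_snd_nonneg R h hx ω u
  suffices hb : Measurable (fun ω => birthState R h x ω u) from ⟨hb, hlife u hb⟩
  induction u with
  | nil => exact measurable_const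
  | cons i u ih =>
    simp only [birthState_cons]
    have h1 := hlife u ih
    have h2 : Measurable fun ω : Noise => ((ω u).2 : ℝ) :=
      measurable_subtype_coe.comp (measurable_pi_apply u).snd
    refine (ih.fst.add h1).prodMk (Measurable.mul ?_ (ih.snd.add h1.coe_nnreal_real))
    split_ifs
    · exact h2
    · exact measurable_const.sub h2

/-- There are countably many words and the factors are second countable, so the Borel structure is
the product one. -/
theorem measurable_treeCode {Ω : Type*} [MeasurableSpace Ω] {f : Ω → TreeCode}
    (h1 : ∀ u, Measurable fun ω => (f ω).1 u)
    (h2 : ∀ u, Measurable[_, borel C(ℝ≥0, ℝ)] fun ω => (f ω).2 u) : Measurable f := by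
  let _ : MeasurableSpace C(ℝ≥0, ℝ) := borel _
  have : BorelSpace C(ℝ≥0, ℝ) := ⟨rfl⟩
  have hprod : Measurable[_, borel ((Word → ℝ≥0) × (Word → C(ℝ≥0, ℝ)))]
      (fun ω => ((f ω).1, (f ω).2)) := by
    rw [← BorelSpace.measurable_eq]
    exact (measurable_pi_iff.2 h1).prodMk (measurable_pi_iff.2 h2)
  exact hprod

theorem measurable_restrict_growthFragmentation (hc : ContinuousOn R (Set.Ico 0 h))
    (hp : ∀ s ∈ Set.Ico (0 : ℝ) h, 0 < R s) (hx : 0 ≤ x) (T : ℝ≥0) :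
    Measurable fun ω => (growthFragmentation R h x ω).restrict T := by
  simp only [restrict_growthFragmentation]
  refine measurable_treeCode (fun u => ?_) fun u => ?_
  · obtain ⟨hb, he⟩ := measurable_birthState hc hp hx u
    exact ((hb.fst.add he).min measurable_const).sub (hb.fst.min measurable_const)
  · obtain ⟨hb, he⟩ := measurable_birthState hc hp hx u
    let _ : MeasurableSpace C(ℝ≥0, ℝ) := borel _
    have : BorelSpace C(ℝ≥0, ℝ) := ⟨rfl⟩
    refine Measurable.ite (measurableSet_le hb.fst measurable_const) ?_ measurable_const
    exact continuous_frozenGrowth.measurable.comp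
      (hb.snd.prodMk (he.prodMk (measurable_const.sub hb.fst)))

end

/-! ### Diffuseness of the birth times -/

instance : NullSingletonClass expLaw := by
  refine ⟨fun a => ?_⟩
  exact withDensity_absolutelyContinuous volume (gammaPDF 1 1) (measure_singleton a)

theorem expLaw_Iic_zero : expLaw (Set.Iic 0) = 0 := by
  rw [measure_congr (Iio_ae_eq_Iic (μ := expLaw) (a := (0 : ℝ))).symm]
  change volume.withDensity (gammaPDF 1 1) (Set.Iio 0) = 0
  rw [withDensity_apply _ measurableSet_Iio]
  exact lintegral_gammaPDF_of_nonpos le_rfl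

theorem map_clock_noiseLaw (u : Word) : noiseLaw.map (fun ω => (ω u).1) = expLaw := by
  have h1 : noiseLaw.map (fun ω => ω u) = expLaw.prod volume := Measure.infinitePi_map_eval _ u
  have h2 := congrArg (fun ν => Measure.map Prod.fst ν) h1
  rwa [Measure.map_map measurable_fst (measurable_pi_apply u), Measure.map_fst_prod,
    measure_univ, one_smul] at h2

/-- A clock is almost surely distinct from any function of the noise of the words that are shorter
than its own. -/
theorem ae_clock_ne {u : Word} {g : Noise → ℝ} (hg : Measurable g)
    (hdep : ∀ ω ω' : Noise, (∀ w : Word, w.length < u.length → ω w = ω' w) → g ω = g ω') :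
    ∀ᵐ ω ∂noiseLaw, (ω u).1 ≠ g ω := by
  classical
  set S : Finset Word := (List.finite_length_lt (Fin 2) u.length).toFinset with hS
  have hmemS : ∀ w : Word, w ∈ S ↔ w.length < u.length := fun w => by simp [hS]
  have hind : iIndepFun (fun (w : Word) (ω : Noise) => ω w) noiseLaw :=
    iIndepFun_infinitePi (X := fun _ z => z) fun _ => measurable_id
  have hind2 := hind.indepFun_finset S {u}
    (Finset.disjoint_singleton_right.2 fun hu => lt_irrefl _ ((hmemS u).1 hu))
    fun w => measurable_pi_apply w
  -- Filling the other words with an arbitrary value exhibits `g` as a function of the finitely many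
  -- shorter words.
  let extend : (S → ℝ × unitInterval) → Noise := fun z w => if hw : w ∈ S then z ⟨w, hw⟩ else (0, 0)
  have hext : Measurable extend := by
    refine measurable_pi_iff.2 fun w => ?_
    by_cases hw : w ∈ S
    · simpa [extend, hw] using measurable_pi_apply _
    · simp [extend, hw]
  have hind3 : IndepFun g (fun ω : Noise => (ω u).1) noiseLaw := by
    have h1 := hind2.comp (hg.comp hext)
      (measurable_pi_apply (⟨u, Finset.mem_singleton_self u⟩ : ({u} : Finset Word))).fst
    refine h1.congr (Eventually.of_forall fun ω => ?_) (Eventually.of_forall fun ω => rfl)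
    refine hdep _ _ fun w hw => ?_
    simp [extend, (hmemS w).2 hw]
  have hclock : Measurable fun ω : Noise => (ω u).1 := (measurable_pi_apply u).fst
  have hmap := (indepFun_iff_map_prod_eq_prod_map_map hg.aemeasurable hclock.aemeasurable).1 hind3
  rw [map_clock_noiseLaw] at hmap
  have hD : MeasurableSet {z : ℝ × ℝ | z.2 = z.1} :=
    measurableSet_eq_fun measurable_snd measurable_fst
  have hnull : noiseLaw.map (fun ω => (g ω, (ω u).1)) {z : ℝ × ℝ | z.2 = z.1} = 0 := by
    rw [hmap, Measure.measure_prod_null hD]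
    refine Eventually.of_forall fun a => ?_
    have : Prod.mk a ⁻¹' {z : ℝ × ℝ | z.2 = z.1} = {a} := by ext; simp
    simp only [this, measure_singleton, Pi.zero_apply]
  rw [Measure.map_apply (hg.prodMk hclock) hD] at hnull
  simpa [ae_iff] using hnull

theorem ae_clock_pos (u : Word) : ∀ᵐ ω ∂noiseLaw, 0 < (ω u).1 := by
  have h1 : noiseLaw ((fun ω : Noise => (ω u).1) ⁻¹' Set.Iic 0) = 0 := by
    rw [← Measure.map_apply (measurable_pi_apply u).fst measurableSet_Iic, map_clock_noiseLaw,
      expLaw_Iic_zero]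
  rw [ae_iff]
  refine measure_mono_null (fun ω hω => ?_) h1
  exact not_lt.1 hω

/-- If a child is born at `T < h`, its parent's clock equals the rate integrated up to age `T -
birth`, a quantity determined by words shorter than the parent. -/
theorem ae_birthState_fst_ne {R : ℝ → ℝ} {h : ℝ≥0} {x : ℝ} (hc : ContinuousOn R (Set.Ico 0 h))
    (hp : ∀ s ∈ Set.Ico (0 : ℝ) h, 0 < R s) (hx : 0 ≤ x) {T : ℝ≥0} (hT0 : 0 < T) (hT : T < h)
    (u : Word) : ∀ᵐ ω ∂noiseLaw, (birthState R h x ω u).1 ≠ T := by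
  cases u with
  | nil => exact Eventually.of_forall fun ω => hT0.ne
  | cons i u =>
    have hb := (measurable_birthState hc hp hx u).1
    filter_upwards [ae_clock_pos u, ae_clock_ne (u := u)
      (g := fun ω => splitIntegral ((Set.Ico (0 : ℝ) h).indicator R) (birthState R h x ω u).1
        (birthState R h x ω u).2 (T - (birthState R h x ω u).1 : ℝ≥0))
      (measurable_splitIntegral (measurable_indicator_rate hc) hb.fst.coe_nnreal_real hb.snd
        (measurable_const.sub hb.fst))
      fun ω ω' hω => by simp only [birthState_congr R h x u hω]] with ω hpos hne heq
    rw [birthState_cons] at heq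
    simp only at heq
    have hlife : T - (birthState R h x ω u).1 = lifetime R h x ω u := by
      rw [← heq, add_tsub_cancel_left]
    have hlt : (birthState R h x ω u).1 + lifetime R h x ω u < h := heq ▸ hT
    rw [hlife, splitIntegral_indicator R hlt] at hne
    exact hne (splitIntegral_splitAge hc hp (birthState_snd_nonneg R h hx ω u) hpos.le hlt).symm

/-! ### The limiting process -/

theorem continuousOn_limitRate :
    ContinuousOn (fun s : ℝ => 2 / (1 - s) ^ 2) (Set.Ico 0 ((1 : ℝ≥0) : ℝ)) := by
  refine continuousOn_const.div (by fun_prop) fun s hs => ?_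
  have h1 : s < 1 := hs.2
  exact pow_ne_zero _ (by linarith)

theorem limitRate_pos : ∀ s ∈ Set.Ico (0 : ℝ) ((1 : ℝ≥0) : ℝ), 0 < 2 / (1 - s) ^ 2 := by
  intro s hs
  have h1 : s < 1 := hs.2
  have h2 : 0 < 1 - s := by linarith
  positivity

/-- The left side is the integral of its own derivative `v(2(1 - b) - v)/(1 - b - v)²`, which is at
most the rate because `v(2(1 - b) - v) ≤ 2(m + v)`. It blows up as `r → 1 - b`, even when `m = 0`.
-/
theorem sq_div_le_splitIntegral_limitRate {b m r : ℝ} (hb : 0 ≤ b) (hm : 0 ≤ m) (hr : 0 ≤ r)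
    (hbr : b + r < 1) :
    r ^ 2 / (1 - b - r) ≤ splitIntegral (fun s => 2 / (1 - s) ^ 2) b m r := by
  have hderiv : ∀ v ∈ Set.uIcc 0 r, HasDerivAt (fun v : ℝ => v ^ 2 / (1 - b - v))
      (v * (2 * (1 - b) - v) / (1 - b - v) ^ 2) v := by
    intro v hv
    rw [Set.uIcc_of_le hr] at hv
    have hne : 1 - b - v ≠ 0 := by linarith [hv.2]
    refine (((hasDerivAt_id v).pow 2).div ((hasDerivAt_id v).const_sub (1 - b)) hne).congr_deriv ?_
    simp only [id, Pi.pow_apply]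
    field_simp
    ring
  have hcont : ContinuousOn (fun v : ℝ => v * (2 * (1 - b) - v) / (1 - b - v) ^ 2)
      (Set.Icc 0 r) := by
    refine ContinuousOn.div (by fun_prop) (by fun_prop) fun v hv => ?_
    exact pow_ne_zero _ (by linarith [hv.2])
  have hint := hcont.intervalIntegrable_of_Icc (μ := volume) hr
  have hval := intervalIntegral.integral_eq_sub_of_hasDerivAt hderiv hint
  have hval' : ∫ v in (0 : ℝ)..r, v * (2 * (1 - b) - v) / (1 - b - v) ^ 2 =
      r ^ 2 / (1 - b - r) := by rw [hval]; simp
  rw [← hval']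
  refine intervalIntegral.integral_mono_on hr hint
    (intervalIntegrable_splitRate continuousOn_limitRate hb le_rfl hr (by simpa using hbr) m)
    fun v hv => ?_
  have hpos : 0 < 1 - b - v := by linarith [hv.2]
  have heq : 2 / (1 - (b + v)) ^ 2 * (m + v) = 2 * (m + v) / (1 - b - v) ^ 2 := by
    rw [← sub_sub]; ring
  rw [heq]
  refine div_le_div_of_nonneg_right ?_ (sq_nonneg _)
  nlinarith [hv.1, mul_nonneg hv.1 hb, sq_nonneg v]

theorem birth_add_splitAge_limitRate_lt {b : ℝ≥0} (hb : b < 1) {m : ℝ} (hm : 0 ≤ m) (E : ℝ) :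
    b + splitAge (fun s => 2 / (1 - s) ^ 2) 1 b m E < 1 := by
  have hb' : (b : ℝ) < 1 := by exact_mod_cast hb
  set c : ℝ := 1 - b with hcdef
  have hc0 : 0 < c := by linarith
  have hc1 : c ≤ 1 := by linarith [NNReal.coe_nonneg b]
  -- Chosen so that `(1 + |E|) d = (c/2)² ≤ (c - d)²`: the lower bound `(c - d)²/d` at age `c - d`
  -- then exceeds `E`.
  set d : ℝ := c ^ 2 / (4 * (1 + |E|)) with hddef
  have hE : 0 ≤ |E| := abs_nonneg E
  have hd0 : 0 < d := by positivity
  have hd1 : d ≤ c / 2 := by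
    rw [hddef, div_le_iff₀ (by positivity)]
    nlinarith [mul_nonneg hc0.le hE]
  have hr0 : 0 ≤ c - d := by linarith
  have hmem : (⟨c - d, hr0⟩ : ℝ≥0) ∈ ripeAges (fun s => 2 / (1 - s) ^ 2) 1 b m E := by
    refine Or.inr ?_
    refine le_trans ?_ (sq_div_le_splitIntegral_limitRate (NNReal.coe_nonneg b) hm hr0
      (by change (b : ℝ) + (c - d) < 1; linarith))
    change E ≤ (c - d) ^ 2 / (c - (c - d))
    rw [sub_sub_cancel, le_div_iff₀ hd0]
    have h1 : (1 + |E|) * d = (c / 2) ^ 2 := by rw [hddef]; field_simp; ring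
    have h2 : (c / 2) ^ 2 ≤ (c - d) ^ 2 := by
      apply pow_le_pow_left₀ <;> linarith
    have h3 : E * d ≤ |E| * d := mul_le_mul_of_nonneg_right (le_abs_self E) hd0.le
    linarith
  have hle : ((splitAge (fun s => 2 / (1 - s) ^ 2) 1 b m E : ℝ≥0) : ℝ) ≤ c - d :=
    NNReal.coe_le_coe.2 (splitAge_le hmem)
  rw [← NNReal.coe_lt_coe]
  push_cast
  linarith

theorem death_limitTree_lt_one {x : ℝ} (hx : 0 ≤ x) (ω : Noise) (u : Word) :
    (birthState (fun s => 2 / (1 - s) ^ 2) 1 x ω u).1 +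
      lifetime (fun s => 2 / (1 - s) ^ 2) 1 x ω u < 1 := by
  refine birth_add_splitAge_limitRate_lt ?_ (birthState_snd_nonneg _ _ hx ω u) _
  induction u with
  | nil => exact zero_lt_one
  | cons i u ih =>
    rw [birthState_cons]
    exact birth_add_splitAge_limitRate_lt ih (birthState_snd_nonneg _ _ hx ω u) _

/-! ### The rescaled red trees -/

section

variable {p lam : ℝ → ℝ}

/-- The splitting rate of the red tree of height `t` rescaled by `t`. -/
def rescaledRate (p lam : ℝ → ℝ) (t : ℝ≥0) (s : ℝ) : ℝ := (t : ℝ) ^ 2 * rho p lam (t - t * s)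

theorem rescale_redTree {t : ℝ≥0} (ht : 0 < t) (y : ℝ) (ω : Noise) :
    (redTree p lam t y ω).rescale t =
      growthFragmentation (rescaledRate p lam t) 1 (y / t) ω := by
  have ht' : (t : ℝ) ≠ 0 := by exact_mod_cast ht.ne'
  have := rescale_growthFragmentation ht (fun s => rho p lam (t - s)) 1 (y / t) ω
  rwa [mul_one, mul_div_cancel₀ y ht'] at this

theorem SolvesSystem.continuousOn_rescaledRate (hsol : SolvesSystem p lam) (t : ℝ≥0) :
    ContinuousOn (rescaledRate p lam t) (Set.Ico 0 ((1 : ℝ≥0) : ℝ)) := by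
  refine continuousOn_const.mul (hsol.continuousOn_rho.comp (by fun_prop) fun s hs => ?_)
  have h1 : s < 1 := hs.2
  exact sub_nonneg.2 (mul_le_of_le_one_right (NNReal.coe_nonneg t) h1.le)

theorem SolvesSystem.rescaledRate_pos (hsol : SolvesSystem p lam)
    (hcrit : (p 0, lam 0) ∈ criticalSet) {t : ℝ≥0} (ht : 0 < t) :
    ∀ s ∈ Set.Ico (0 : ℝ) ((1 : ℝ≥0) : ℝ), 0 < rescaledRate p lam t s := by
  intro s hs
  have h1 : s < 1 := hs.2
  have ht' : (0 : ℝ) < t := by exact_mod_cast ht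
  exact mul_pos (by positivity) (hsol.rho_pos hcrit
    (sub_nonneg.2 (mul_le_of_le_one_right (NNReal.coe_nonneg t) h1.le)))

/-- With `w = t(1 - s)`, the rescaled rate is `w² ρ(w)/(1 - s)²`. On `[0, S]`, `w ≥ t(1 - S)` tends
to infinity uniformly and the denominator is at least `(1 - S)²`. -/
theorem SolvesSystem.tendstoUniformlyOn_rescaledRate (hsol : SolvesSystem p lam)
    (hcrit : (p 0, lam 0) ∈ criticalSet) {S : ℝ} (hS : S < ((1 : ℝ≥0) : ℝ)) :
    TendstoUniformlyOn (rescaledRate p lam) (fun s => 2 / (1 - s) ^ 2) atTop (Set.Icc 0 S) := by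
  have hS' : 0 < 1 - S := by
    have : S < 1 := hS
    linarith
  refine Metric.tendstoUniformlyOn_iff.2 fun δ hδ => ?_
  have hδ' : 0 < δ * (1 - S) ^ 2 := by positivity
  obtain ⟨w₀, hw₀⟩ := Metric.tendsto_atTop.1 (hsol.tendsto_sq_mul_rho hcrit) _ hδ'
  have htop : Tendsto (fun t : ℝ≥0 => (t : ℝ) * (1 - S)) atTop atTop :=
    (NNReal.tendsto_coe_atTop.2 tendsto_id).atTop_mul_const hS'
  filter_upwards [htop.eventually_ge_atTop w₀] with t ht s hs
  have hs1 : 1 - S ≤ 1 - s := by linarith [hs.2]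
  have hs0 : 0 < 1 - s := by linarith
  have h1 := hw₀ (t * (1 - s)) (ht.trans (by gcongr))
  have h2 : rescaledRate p lam t s =
      (t * (1 - s)) ^ 2 * rho p lam (t * (1 - s)) / (1 - s) ^ 2 := by
    unfold rescaledRate
    rw [show (t : ℝ) - t * s = t * (1 - s) by ring]
    field_simp
  rw [dist_comm, Real.dist_eq, h2, ← sub_div, abs_div, abs_of_pos (show 0 < (1 - s) ^ 2 by positivity),
    div_lt_iff₀ (by positivity)]
  rw [Real.dist_eq] at h1
  refine h1.trans_le ?_
  gcongr

end

end

end RedTree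

theorem theorem5 (p lam : ℝ → ℝ)
    (hcrit : (p 0, lam 0) ∈ RedTree.criticalSet)
    (hsol : RedTree.SolvesSystem p lam)
    (y : ℝ≥0 → ℝ) (hy : ∀ t, 0 < y t)
    (x : ℝ) (hx : 0 ≤ x) (hyx : Tendsto (fun t : ℝ≥0 => y t / (t : ℝ)) atTop (𝓝 x))
    (ε : ℝ≥0) (hε0 : 0 < ε) (hε1 : ε < 1) :
    TendstoInDistribution
      (fun (t : ℝ≥0) (ω : RedTree.Noise) =>
        ((RedTree.redTree p lam t (y t) ω).rescale t).restrict (1 - ε))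
      atTop
      (fun ω : RedTree.Noise => (RedTree.limitTree x ω).restrict (1 - ε))
      (fun _ => RedTree.noiseLaw) RedTree.noiseLaw := by
  have hT0 : 0 < 1 - ε := tsub_pos_of_lt hε1
  have hT1 : 1 - ε < 1 := tsub_lt_self one_pos hε0
  have hy0 : ∀ t : ℝ≥0, 0 ≤ y t / t := fun t => div_nonneg (hy t).le t.2
  refine tendstoInDistribution_of_ae_tendsto (fun t => ?_) ?_ ?_
  · rcases t.2.eq_or_lt with h0 | h0
    · obtain rfl : t = 0 := NNReal.coe_injective h0.symm
      refine (measurable_const (a := ((RedTree.redTree p lam 0 (y 0) fun _ => (0, 0)).rescale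
        0).restrict (1 - ε))).aemeasurable.congr (Eventually.of_forall fun ω => ?_)
      simp only [RedTree.rescale_zero (RedTree.redTree p lam 0 (y 0) ω)
        (RedTree.redTree p lam 0 (y 0) fun _ => (0, 0))]
    · have ht : 0 < t := h0
      simp only [RedTree.rescale_redTree ht]
      exact (RedTree.measurable_restrict_growthFragmentation (hsol.continuousOn_rescaledRate t)
        (hsol.rescaledRate_pos hcrit ht) (hy0 t) _).aemeasurable
  · exact (RedTree.measurable_restrict_growthFragmentation RedTree.continuousOn_limitRate
      RedTree.limitRate_pos hx _).aemeasurable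
  -- Words are countable, so almost surely no particle at all is born at time `1 - ε`.
  · filter_upwards [ae_all_iff.2 (RedTree.ae_birthState_fst_ne RedTree.continuousOn_limitRate
      RedTree.limitRate_pos hx hT0 hT1)] with ω hω
    have hlim := RedTree.tendsto_restrict_growthFragmentation (T := 1 - ε)
      (RedTree.tendsto_birthState
        (Eventually.of_forall hsol.continuousOn_rescaledRate) RedTree.continuousOn_limitRate
        ((eventually_gt_atTop 0).mono fun t ht => hsol.rescaledRate_pos hcrit ht)
        RedTree.limitRate_pos (fun S hS => hsol.tendstoUniformlyOn_rescaledRate hcrit hS)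
        hyx (Eventually.of_forall hy0) hx (RedTree.death_limitTree_lt_one hx ω)) hω
    refine hlim.congr' ?_
    filter_upwards [eventually_gt_atTop 0] with t ht
    rw [RedTree.rescale_redTree ht]
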